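/- Let $\pi\colon X\to X_0=\mathbb P^1\times\mathbb P^1\times\mathbb P^1$ (coordinate pairs $(a_0:a_1),(b_0:b_1),(c_0:c_1)$) be the toric threefold over $\mathbb Q$ obtained by blowing up the line $l_1=V(a_1,b_1)$ and then (the strict transform of) the line $l_2=V(a_1,c_1)$. Its Cox ring is $\mathbb Q[a_0,a_1,b_0,b_1,c_0,c_1,x,y]$, graded by $\operatorname{Pic}X\cong\mathbb Z^5$ with degrees $a_0:(1,0,0,0,0)$, $a_1:(1,0,0,-1,-1)$, $b_0:(0,1,0,0,0)$, $b_1:(0,1,0,-1,0)$, $c_0:(0,0,1,0,0)$, $c_1:(0,0,1,0,-1)$, $x:(0,0,0,1,0)$, $y:(0,0,0,0,1)$, and in Cox coordinates $\pi$ is $((a_0:a_1xy),(b_0:b_1x),(c_0:c_1y))$. Let $E_1=V(x)$, $E_2=V(y)$ be the exceptional divisors, $M=V(a_0)$ the preimage of the plane $\{a_0=0\}$, $D=E_1+E_2+M$, $U=X\setminus D\cong X_0\setminus(V(a_0)\cup l_1\cup l_2)$, and let $\mathfrak U=(\mathbb P^1_{\mathbb Z})^3\setminus\overline{V(a_0)\cup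 l_1\cup l_2}$, an integral model of $U$. Equip the log anticanonical bundle $\omega_X(D)^\vee\cong\mathcal L_1\otimes\mathcal L_2^\vee$ (with $\mathcal L_1$ of class $(2,2,2,-2,-2)$ and $\mathcal L_2$ of class $(1,0,0,0,0)$) at every place $v$ of $\mathbb Q$ with the quotient of the metrics $\|s\|_v=|s|_v/\max_k|s_k|_v$ on $\mathcal L_1$, $\mathcal L_2$ that are induced by the base point free tuples of sections $(a_1^2b_0^2c_0^2,\ a_1^2b_1^2c_0^2x^2,\ a_1^2b_0^2c_1^2y^2,\ a_1^2b_1^2c_1^2x^2y^2,\ a_0^2b_1^2c_1^2)$ and $(a_0,\ a_1xy)$, and equip $\omega_X(D)$ with the dual metric. Here $\omega_X$ is identified with the line bundle of its class in such a way that $\mathrm da\wedge\mathrm db\wedge\mathrm dc$, for $a=a_0/(a_1xy)$, $b=b_0/(b_1x)$, $c=c_0/(c_1y)$, corresponds to $a_1^{-2}b_1^{-2}c_1^{-2}x^{-3}y^{-3}$, and the canonical section $1_D$ of $\mathcal O_X(D)$ corresponds to $a_0xy$. Use Lebesgue measure on $\mathbb R$ and the Haar measure with $\operatorname{vol}(\mathbb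 Z_p)=1$ on $\mathbb Q_p$. Let $\tau_{U,p}$ be the restriction to $U(\mathbb Q_p)$ of the Tamagawa measure given in local coordinates of $X(\mathbb Q_p)$ by $\mathrm du_0\,\mathrm du_1\,\mathrm du_2/\|1_D\otimes \mathrm du_0\wedge \mathrm du_1\wedge \mathrm du_2\|_p$. Let $\tau_{(M,E_1+E_2),\infty}$ be the measure on $M(\mathbb R)$ given in local coordinates by $\mathrm dv_0\,\mathrm dv_1/\|1_{E_1+E_2}\otimes \mathrm dv_0\wedge \mathrm dv_1\|_\infty$, with the metric on $\omega_M\otimes\mathcal O_X(E_1+E_2)|_M\cong\omega_X(D)|_M$ induced by adjunction, and let $\tau_{M,\infty}=c_{\mathbb R}\,\tau_{(M,E_1+E_2),\infty}$ be the residue measure, renormalized by $c_{\mathbb R}=\operatorname{vol}([-1,1])=2$. Then $$\tau_{(M,E_1+E_2),\infty}(M(\mathbb R))=16,\qquad \tau_{M,\infty}(M(\mathbb R))=2\cdot 16=32,$$ and for every prime $p$ $$\tau_{U,p}(\mathfrak U(\mathbb Z_p))=1+\frac2p-\frac1{p^2}-\frac1{p^3}.$$ -/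

import Mathlib

open Filter MeasureTheory Topology
open scoped LinearAlgebra.Projectivization ENNReal

noncomputable section

namespace ToricThreefold

/-! ### The fan and the Cox ring -/

/-- The rays of the fan of `X`, which are also the names of the generators of its Cox ring
`ℤ[a₀, a₁, b₀, b₁, c₀, c₁, x, y]`. -/
inductive Ray
  | a₀ | a₁ | b₀ | b₁ | c₀ | c₁ | x | y
  deriving DecidableEq

open Ray

instance : Fintype Ray := ⟨{a₀, a₁, b₀, b₁, c₀, c₁, x, y}, fun ρ => by cases ρ <;> decide⟩

/-- Primitive generators of the rays: the fan of `ℙ¹ × ℙ¹ × ℙ¹` together with the two rays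
`x` (first blow-up) and `y` (second blow-up). -/
def rayVector : Ray → Fin 3 → ℤ
  | a₀ => ![1, 0, 0]
  | a₁ => ![-1, 0, 0]
  | b₀ => ![0, 1, 0]
  | b₁ => ![0, -1, 0]
  | c₀ => ![0, 0, 1]
  | c₁ => ![0, 0, -1]
  | x => ![-1, -1, 0]
  | y => ![-1, 0, -1]

/-- The twelve maximal cones of the fan, each given by its three rays.  They arise from the eight
octants by the star subdivision at `x` followed by the star subdivision at `y`.
The cones containing `a₀` are the first four, and they list `a₀` first. -/
def cone : Fin 12 → Fin 3 → Ray :=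
  ![![a₀, b₀, c₀], ![a₀, b₁, c₀], ![a₀, b₀, c₁], ![a₀, b₁, c₁],
    ![a₁, b₀, c₀],
    ![a₁, x, c₀], ![x, b₁, c₀],
    ![a₁, b₀, y], ![y, b₀, c₁],
    ![a₁, x, y], ![y, x, c₁], ![x, b₁, c₁]]

/-- The degrees of the generators of the Cox ring in `Pic X ≅ ℤ⁵`. -/
def degree : Ray → Fin 5 → ℤ
  | a₀ => ![1, 0, 0, 0, 0]
  | a₁ => ![1, 0, 0, -1, -1]
  | b₀ => ![0, 1, 0, 0, 0]
  | b₁ => ![0, 1, 0, -1, 0]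
  | c₀ => ![0, 0, 1, 0, 0]
  | c₁ => ![0, 0, 1, 0, -1]
  | x => ![0, 0, 0, 1, 0]
  | y => ![0, 0, 0, 0, 1]

/-! ### The variety `X` -/

section Variety

variable {K : Type*} [Field K]

/-- The character of `𝔾ₘ⁵` given by an element of `Pic X ≅ ℤ⁵`. -/
def character (d : Fin 5 → ℤ) (t : Fin 5 → Kˣ) : Kˣ := ∏ k, t k ^ d k

variable (K) in
/-- `K`-points of the universal torsor `Y = Spec R_X ∖ V(I_irr)`: the irrelevant ideal is generated
by the products of the generators whose rays do not belong to `σ`, for the maximal cones `σ`. -/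
def Y : Type _ := {z : Ray → K // ∃ i, ∀ ρ, (∀ j, cone i j ≠ ρ) → z ρ ≠ 0}

instance : MulAction (Fin 5 → Kˣ) (Y K) where
  smul t z := ⟨fun ρ => (character (degree ρ) t : K) * z.1 ρ, by
    obtain ⟨i, hi⟩ := z.2
    exact ⟨i, fun ρ hρ => mul_ne_zero (Units.ne_zero _) (hi ρ hρ)⟩⟩
  one_smul z := Subtype.ext (funext fun ρ => by
    change ((character (degree ρ) (1 : Fin 5 → Kˣ) : Kˣ) : K) * z.1 ρ = z.1 ρ
    simp [character])
  mul_smul s t z := Subtype.ext (funext fun ρ => by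
    change ((character (degree ρ) (s * t) : Kˣ) : K) * z.1 ρ =
      (character (degree ρ) s : K) * ((character (degree ρ) t : K) * z.1 ρ)
    simp [character, mul_zpow, Finset.prod_mul_distrib, mul_assoc])

variable (K) in
/-- `K`-points of `X`: since `Y → X` is a torsor under the split torus `𝔾ₘ⁵`, they are the orbits
of `𝔾ₘ⁵(K)` on `Y(K)`; the orbit of `z` is the point with Cox coordinates `z`. -/
def X : Type _ := Quotient (MulAction.orbitRel (Fin 5 → Kˣ) (Y K))

/-- The point `(a₀ : a₁ : b₀ : b₁ : c₀ : c₁ : x : y)` of `X` given in Cox coordinates. -/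
def toX (z : Y K) : X K := Quotient.mk _ z

/-- The torus invariant prime divisor given by the vanishing of a generator of the Cox ring. -/
def divisor (ρ : Ray) : Set (X K) := {P | ∃ z : Y K, toX z = P ∧ z.1 ρ = 0}

variable (K) in
/-- The boundary component `M = V(a₀)`. -/
def M : Set (X K) := divisor a₀

variable (K) in
/-- The open subvariety `U = X ∖ (E₁ ∪ E₂ ∪ M)`, where `E₁ = V(x)` and `E₂ = V(y)` are the two
exceptional divisors. -/
def U : Set (X K) := (divisor x ∪ divisor y ∪ M K)ᶜ

/-! ### The blow-up morphism `π : X → ℙ¹ × ℙ¹ × ℙ¹` and the integral points -/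

variable (K) in
/-- `K`-points of `X₀ = ℙ¹ × ℙ¹ × ℙ¹`. -/
abbrev X₀ : Type _ := ℙ K (Fin 2 → K) × ℙ K (Fin 2 → K) × ℙ K (Fin 2 → K)

lemma pair_ne_zero {u v : K} (h : u ≠ 0 ∨ v ≠ 0) : ![u, v] ≠ 0 := by
  intro h0
  have h1 := congrFun h0 0
  have h2 := congrFun h0 1
  simp_all

lemma Y.a_ne (z : Y K) : ![z.1 a₀, z.1 a₁ * z.1 x * z.1 y] ≠ 0 := by
  obtain ⟨i, hi⟩ := z.2
  apply pair_ne_zero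
  have : ∀ i, (∀ j, cone i j ≠ a₀) ∨
      ((∀ j, cone i j ≠ a₁) ∧ (∀ j, cone i j ≠ x) ∧ (∀ j, cone i j ≠ y)) := by decide
  rcases this i with h | ⟨h, h', h''⟩
  · exact Or.inl (hi _ h)
  · exact Or.inr (mul_ne_zero (mul_ne_zero (hi _ h) (hi _ h')) (hi _ h''))

lemma Y.b_ne (z : Y K) : ![z.1 b₀, z.1 b₁ * z.1 x] ≠ 0 := by
  obtain ⟨i, hi⟩ := z.2
  apply pair_ne_zero
  have : ∀ i, (∀ j, cone i j ≠ b₀) ∨ ((∀ j, cone i j ≠ b₁) ∧ (∀ j, cone i j ≠ x)) := by decide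
  rcases this i with h | ⟨h, h'⟩
  · exact Or.inl (hi _ h)
  · exact Or.inr (mul_ne_zero (hi _ h) (hi _ h'))

lemma Y.c_ne (z : Y K) : ![z.1 c₀, z.1 c₁ * z.1 y] ≠ 0 := by
  obtain ⟨i, hi⟩ := z.2
  apply pair_ne_zero
  have : ∀ i, (∀ j, cone i j ≠ c₀) ∨ ((∀ j, cone i j ≠ c₁) ∧ (∀ j, cone i j ≠ y)) := by decide
  rcases this i with h | ⟨h, h'⟩
  · exact Or.inl (hi _ h)
  · exact Or.inr (mul_ne_zero (hi _ h) (hi _ h'))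

/-- The blow-up morphism in Cox coordinates,
`z ↦ ((a₀ : a₁xy), (b₀ : b₁x), (c₀ : c₁y))`. -/
def blowDown : X K → X₀ K :=
  Quotient.lift (fun z : Y K => (Projectivization.mk K _ z.a_ne, Projectivization.mk K _ z.b_ne,
      Projectivization.mk K _ z.c_ne)) (by
    rintro z w ⟨t, rfl⟩
    refine Prod.ext ?_ (Prod.ext ?_ ?_) <;>
      refine (Projectivization.mk_eq_mk_iff' K _ _ _ _).2 ?_
    · refine ⟨t 0, ?_⟩
      change _ = ![(character (degree a₀) t : K) * w.1 a₀, (character (degree a₁) t : K) * w.1 a₁ *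
        ((character (degree x) t : K) * w.1 x) * ((character (degree y) t : K) * w.1 y)]
      ext k
      fin_cases k <;> simp [character, degree, Fin.prod_univ_succ]
      field_simp
    · refine ⟨t 1, ?_⟩
      change _ = ![(character (degree b₀) t : K) * w.1 b₀, (character (degree b₁) t : K) * w.1 b₁ *
        ((character (degree x) t : K) * w.1 x)]
      ext k
      fin_cases k <;> simp [character, degree, Fin.prod_univ_succ]
      field_simp
    · refine ⟨t 2, ?_⟩
      change _ = ![(character (degree c₀) t : K) * w.1 c₀, (character (degree c₁) t : K) * w.1 c₁ *
        ((character (degree y) t : K) * w.1 y)]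
      ext k
      fin_cases k <;> simp [character, degree, Fin.prod_univ_succ]
      field_simp)

/-! ### Charts -/

/-- The affine chart of `X` associated with the `i`-th maximal cone `σ`: the locus where all
generators belonging to rays outside `σ` are invertible. -/
def chart (i : Fin 12) : Set (X K) :=
  {P | ∃ z : Y K, toX z = P ∧ ∀ ρ, (∀ j, cone i j ≠ ρ) → z.1 ρ ≠ 0}

/-- Cox coordinates of the point with coordinates `u` in the `i`-th chart `𝔸³`: the generators
belonging to the rays of the cone are `u₀, u₁, u₂`, all the others are `1`. -/
def lift (i : Fin 12) (u : Fin 3 → K) : Y K :=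
  ⟨fun ρ => ∏ j, if cone i j = ρ then u j else 1, i, fun ρ hρ => by simp [hρ]⟩

/-- The parametrization `𝔸³ → X` of the `i`-th chart.  For `i = 0` it is
`(a, b, c) ↦ (a : 1 : b : 1 : c : 1 : 1 : 1)`. -/
def param (i : Fin 12) (u : Fin 3 → K) : X K := toX (lift i u)

/-- The matrix whose rows are the generators of the rays of the `i`-th cone; it is in `GL₃(ℤ)`. -/
def coneMatrix (i : Fin 12) : Matrix (Fin 3) (Fin 3) ℤ := Matrix.of fun j => rayVector (cone i j)

/-- The pairing of the `j`-th element of the basis of the character lattice dual to the rays of the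
`i`-th cone with the generator of the ray `ρ`. -/
def coordExponent (i : Fin 12) (j : Fin 3) (ρ : Ray) : ℤ :=
  Matrix.vecMul (rayVector ρ) (coneMatrix i)⁻¹ j

/-- The local coordinate functions `u₀, u₁, u₂` of the `i`-th chart, as Laurent monomials of degree
zero in the Cox coordinates.
For `i = 0` they are `a = a₀/(a₁xy)`, `b = b₀/(b₁x)`, `c = c₀/(c₁y)`. -/
def coord (i : Fin 12) (j : Fin 3) (z : Ray → K) : K := ∏ ρ, z ρ ^ coordExponent i j ρ

/-- The element of degree `ω_X` of the (localized) Cox ring that corresponds to the local generator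
`du₀ ∧ du₁ ∧ du₂` of the canonical bundle on the `i`-th chart under the isomorphism
`ω_X ≅ 𝓛_{ω_X}`, namely `u₀u₁u₂ / (a₀a₁b₀b₁c₀c₁xy)`, written as a Laurent monomial in
the generators that are invertible on the chart.  For `i = 0`, the form `da ∧ db ∧ dc`
corresponds to `a₁⁻² b₁⁻² c₁⁻² x⁻³ y⁻³`.  (Signs are irrelevant for norms and are ignored.) -/
def canonicalForm (i : Fin 12) (z : Ray → K) : K :=
  ∏ ρ, z ρ ^ ((∑ j, coordExponent i j ρ) - 1)

/-- The canonical section `1_D` of `𝒪(D)`, `D = E₁ + E₂ + M`, in Cox coordinates. -/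
def oneD (z : Ray → K) : K := z a₀ * z x * z y

theorem isUnit_det_coneMatrix (i) : IsUnit (coneMatrix i).det := by
  revert i; decide

theorem coneMatrix_zero_inv : (coneMatrix 0)⁻¹ = 1 := by
  have : coneMatrix 0 = 1 := by decide
  rw [this, inv_one]

theorem coordExponent_zero (j ρ) : coordExponent 0 j ρ = rayVector ρ j := by
  simp [coordExponent, coneMatrix_zero_inv]

theorem prod_ray {A : Type*} [CommMonoid A] (f : Ray → A) : ∏ ρ, f ρ =
    f a₀ * f a₁ * f b₀ * f b₁ * f c₀ * f c₁ * f x * f y := by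
  change ∏ ρ ∈ {a₀, a₁, b₀, b₁, c₀, c₁, x, y}, f ρ = _
  simp [mul_assoc]

/-- The form `da ∧ db ∧ dc` in Cox coordinates. -/
theorem canonicalForm_zero (z : Ray → K) : canonicalForm 0 z =
    z a₁ ^ (-2 : ℤ) * z b₁ ^ (-2 : ℤ) * z c₁ ^ (-2 : ℤ) * z x ^ (-3 : ℤ) * z y ^ (-3 : ℤ) := by
  simp [canonicalForm, coordExponent_zero, prod_ray, Fin.sum_univ_succ, rayVector]

theorem coordExponent_cone (i j k) : coordExponent i j (cone i k) = if k = j then 1 else 0 := by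
  have h : rayVector (cone i k) = (coneMatrix i) k := rfl
  have h2 : coordExponent i j (cone i k) = (coneMatrix i * (coneMatrix i)⁻¹) k j := by
    rw [coordExponent, h]; rfl
  rw [h2, Matrix.mul_nonsing_inv _ (isUnit_det_coneMatrix i), Matrix.one_apply]

theorem cone_injective : ∀ i, Function.Injective (cone i) := by decide

theorem lift_cone (i j) (u : Fin 3 → K) : (lift i u).1 (cone i j) = u j := by
  simp [lift, (cone_injective i).eq_iff]

theorem lift_off (i ρ) (u : Fin 3 → K) (h : ∀ j, cone i j ≠ ρ) :
    (lift i u).1 ρ = 1 := by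
  simp [lift, h]

theorem canonicalForm_lift (i) (u : Fin 3 → K) : canonicalForm i (lift i u).1 = 1 := by
  apply Finset.prod_eq_one
  intro ρ _
  by_cases h : ∃ k, cone i k = ρ
  · obtain ⟨k, rfl⟩ := h
    simp [coordExponent_cone]
  · push Not at h
    simp [lift_off _ _ _ h]

/-- The coordinate functions are inverse to the parametrization of the chart. -/
theorem coord_lift (i j) (u : Fin 3 → K) : coord i j (lift i u).1 = u j := by
  rw [coord, Finset.prod_eq_single (cone i j)]
  · simp [coordExponent_cone, lift_cone]
  · intro ρ _ hne
    by_cases h : ∃ k, cone i k = ρ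
    · obtain ⟨k, rfl⟩ := h
      have : k ≠ j := fun e => hne (by rw [e])
      simp [coordExponent_cone, this]
    · push Not at h
      simp [lift_off _ _ _ h]
  · simp

theorem coord_lift_eq_prod (i i' k) (u : Fin 3 → K) :
    coord i' k (lift i u).1 = ∏ j, u j ^ coordExponent i' k (cone i j) := by
  rw [coord, ← Finset.prod_subset (Finset.subset_univ (Finset.univ.image (cone i))),
    Finset.prod_image (fun a _ b _ h => cone_injective i h)]
  · simp [lift_cone]
  · intro ρ _ h
    rw [lift_off, one_zpow]
    simpa using h

end Variety

/-- The set `𝔘(ℤ_p) ⊆ X₀(ℚ_p)` of `p`-adic integral points of the model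
`𝔘 = ℙ¹_ℤ × ℙ¹_ℤ × ℙ¹_ℤ ∖ closure (V(a₀) ∪ l₁ ∪ l₂)`, `l₁ = V(a₁, b₁)`, `l₂ = V(a₁, c₁)`:
points with primitive homogeneous coordinates over `ℤ_p` whose reduction modulo `p` lies neither on
`V(a₀)` nor on `l₁` nor on `l₂`. -/
def integralModel (p : ℕ) [Fact p.Prime] : Set (X₀ ℚ_[p]) :=
  {P | ∃ (a b c : Fin 2 → ℤ_[p])
      (ha : (fun k => (a k : ℚ_[p])) ≠ 0) (hb : (fun k => (b k : ℚ_[p])) ≠ 0)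
      (hc : (fun k => (c k : ℚ_[p])) ≠ 0),
    P = (Projectivization.mk ℚ_[p] _ ha, Projectivization.mk ℚ_[p] _ hb,
      Projectivization.mk ℚ_[p] _ hc) ∧
    IsCoprime (a 0) (a 1) ∧ IsCoprime (b 0) (b 1) ∧ IsCoprime (c 0) (c 1) ∧
    IsUnit (a 0) ∧ IsCoprime (a 1) (b 1) ∧ IsCoprime (a 1) (c 1)}

/-- The set `𝔘(ℤ_p)` as a subset of `U(ℚ_p) ⊆ X(ℚ_p)`, via the isomorphism `π : U ≅ U₀`. -/
def integralPoints (p : ℕ) [Fact p.Prime] : Set (X ℚ_[p]) :=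
  U ℚ_[p] ∩ blowDown ⁻¹' integralModel p

/-! ### Metrics

An element of the fibre over the point `toX z` of the line bundle of class `d ∈ Pic X` is described,
relative to the Cox coordinates `z`, by a scalar `w`; the pairs `(z, w)` and `(t • z, tᵈ w)`,
`t ∈ 𝔾ₘ⁵`, describe the same element. -/

section Metric

variable {K : Type*} [NormedField K]

/-- The base point free sections of `𝓛₁`, of class `(2, 2, 2, -2, -2)`. -/
def sections₁ : Fin 5 → MvPolynomial Ray ℤ :=
  let X := @MvPolynomial.X ℤ Ray _
  ![X a₁ ^ 2 * X b₀ ^ 2 * X c₀ ^ 2,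
    X a₁ ^ 2 * X b₁ ^ 2 * X c₀ ^ 2 * X x ^ 2,
    X a₁ ^ 2 * X b₀ ^ 2 * X c₁ ^ 2 * X y ^ 2,
    X a₁ ^ 2 * X b₁ ^ 2 * X c₁ ^ 2 * X x ^ 2 * X y ^ 2,
    X a₀ ^ 2 * X b₁ ^ 2 * X c₁ ^ 2]

/-- The base point free sections of `𝓛₂`, of class `(1, 0, 0, 0, 0)`. -/
def sections₂ : Fin 2 → MvPolynomial Ray ℤ :=
  let X := @MvPolynomial.X ℤ Ray _
  ![X a₀, X a₁ * X x * X y]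

/-- The metric on a line bundle induced by a base point free tuple of sections `s`:
`‖w‖ = min_k |w / s_k(z)| = |w| / max_k |s_k(z)|`. -/
def sectionNorm {n : ℕ} (s : Fin n → MvPolynomial Ray ℤ) (z : Ray → K) (w : K) : ℝ :=
  ‖w‖ / ⨆ k, ‖MvPolynomial.aeval z (s k)‖

/-- The quotient metric on `ω_X(D)^∨ ≅ 𝓛₁ ⊗ 𝓛₂^∨`: `‖g‖ = ‖g ⊗ f‖ / ‖f‖`, where `f` is the
element `1` of the fibre of `𝓛₂`. -/
def logAnticanonicalNorm (z : Ray → K) (g : K) : ℝ :=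
  sectionNorm sections₁ z (g * 1) / sectionNorm sections₂ z 1

/-- The dual metric on `ω_X(D)`: `‖h‖ = |⟨h, g⟩| / ‖g‖`, where `g` is the element `1` of the fibre
of `ω_X(D)^∨`. -/
def logCanonicalNorm (z : Ray → K) (h : K) : ℝ :=
  ‖h * 1‖ / logAnticanonicalNorm z 1

theorem smul_apply (t : Fin 5 → Kˣ) (z : Y K) (ρ) :
    (t • z).1 ρ = (character (degree ρ) t : K) * z.1 ρ := rfl

theorem aeval_smul_sections₁ (t : Fin 5 → Kˣ) (z : Y K) (k) :
    MvPolynomial.aeval (t • z).1 (sections₁ k) = (character ![2, 2, 2, -2, -2] t : K) *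
      MvPolynomial.aeval z.1 (sections₁ k) := by
  fin_cases k <;> simp [sections₁, smul_apply, character, degree, Fin.prod_univ_succ] <;>
    field_simp

theorem aeval_smul_sections₂ (t : Fin 5 → Kˣ) (z : Y K) (k) :
    MvPolynomial.aeval (t • z).1 (sections₂ k) = (character ![1, 0, 0, 0, 0] t : K) *
      MvPolynomial.aeval z.1 (sections₂ k) := by
  fin_cases k <;> simp [sections₂, smul_apply, character, degree, Fin.prod_univ_succ] <;>
    field_simp

theorem sectionNorm_smul {n : ℕ} {s : Fin n → MvPolynomial Ray ℤ} {z z' : Ray → K} (c : Kˣ)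
    (h : ∀ k, MvPolynomial.aeval z' (s k) = c * MvPolynomial.aeval z (s k)) (w : K) :
    sectionNorm s z' w = ‖(c : K)‖⁻¹ * sectionNorm s z w := by
  simp only [sectionNorm, h, norm_mul, ← Real.mul_iSup_of_nonneg (norm_nonneg _)]
  field_simp

/-- The metric on `ω_X(D)`, whose class is `(-1, -2, -2, 2, 2)`, is well defined on `X`. -/
theorem logCanonicalNorm_smul (t : Fin 5 → Kˣ) (z : Y K) (h : K) :
    logCanonicalNorm (t • z).1 ((character ![-1, -2, -2, 2, 2] t : K) * h) =
      logCanonicalNorm z.1 h := by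
  simp only [logCanonicalNorm, logAnticanonicalNorm, sectionNorm_smul _ (aeval_smul_sections₁ t z),
    sectionNorm_smul _ (aeval_smul_sections₂ t z)]
  have e : character ![-1, -2, -2, 2, 2] t =
      (character ![2, 2, 2, -2, -2] t)⁻¹ * character ![1, 0, 0, 0, 0] t := by
    ext
    simp [character, Fin.prod_univ_succ]
    field_simp
  have h1 : ‖((character ![2, 2, 2, -2, -2] t : Kˣ) : K)‖ ≠ 0 := by simp
  have h2 : ‖((character ![1, 0, 0, 0, 0] t : Kˣ) : K)‖ ≠ 0 := by simp
  rw [e]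
  simp only [Units.val_mul, norm_mul, Units.val_inv_eq_inv_val, norm_inv]
  field_simp

/-- The value of `‖1_D ⊗ du₀ ∧ du₁ ∧ du₂‖_{ω_X(D)}` at the point with coordinates `u` in the `i`-th
chart. -/
def formNorm (i : Fin 12) (u : Fin 3 → K) : ℝ :=
  logCanonicalNorm (lift i u).1 (oneD (lift i u).1 * canonicalForm i (lift i u).1)

/-- For a chart in which `M` is given by `u₀ = 0`, the value of `‖1_{E₁ + E₂} ⊗ dv₀ ∧ dv₁‖` at the
point of `M` with coordinates `v` in the metric on `ω_M(E₁ + E₂)` that the adjunction isomorphism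
`ω_M ⊗ 𝒪(E₁ + E₂)|_M ≅ ω_X(D)|_M` induces: the norm of
`u₀⁻¹ 1_{E₁ + E₂} ⊗ du₀ ∧ dv₀ ∧ dv₁ = u₀⁻¹ • (1_D ⊗ du₀ ∧ dv₀ ∧ dv₁)`, extended from
the complement of `M` to `M` by taking the limit `u₀ → 0`. -/
def residueFormNorm (i : Fin 12) (v : Fin 2 → K) : ℝ :=
  limUnder (𝓝[≠] (0 : K)) fun t : K => ‖t⁻¹‖ * formNorm i (Fin.cons t v)

end Metric

/-! ### Tamagawa measures -/

section Measures

variable {K : Type*} [NontriviallyNormedField K]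

/-- The local generators `du₀ ∧ du₁ ∧ du₂` on the various charts match under coordinate changes:
they differ by the Jacobian determinant (up to sign). -/
theorem canonicalForm_jacobian (i i' : Fin 12) (u : Fin 3 → K)
    (hu : ∀ j, u j ≠ 0) :
    ‖canonicalForm i' (lift i u).1‖ = ‖(Matrix.of fun k j => deriv
      (fun t => coord i' k (lift i (Function.update u j t)).1) (u j)).det‖ *
      ‖canonicalForm i (lift i u).1‖ := by
  set E : Matrix (Fin 3) (Fin 3) ℤ := (coneMatrix i * (coneMatrix i')⁻¹).transpose with hE
  have hEe : ∀ k j, coordExponent i' k (cone i j) = E k j := fun k j => rfl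
  have hdE : IsUnit E.det := by
    rw [hE, Matrix.det_transpose, Matrix.det_mul]
    exact (isUnit_det_coneMatrix i).mul (Matrix.isUnit_nonsing_inv_det _ (isUnit_det_coneMatrix i'))
  have hd : (Matrix.of fun k j => deriv
      (fun t => coord i' k (lift i (Function.update u j t)).1) (u j)) =
      Matrix.diagonal (fun k => coord i' k (lift i u).1) * E.map (Int.castRingHom K) *
        Matrix.diagonal (fun j => (u j)⁻¹) := by
    ext k j
    simp only [Matrix.of_apply, Matrix.mul_diagonal, Matrix.diagonal_mul, Matrix.map_apply,
      coord_lift_eq_prod, hEe]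
    have : (fun t => ∏ l, Function.update u j t l ^ E k l) =
        fun t => (∏ l ∈ Finset.univ.erase j, u l ^ E k l) * t ^ E k j := by
      ext t
      rw [← Finset.prod_erase_mul _ _ (Finset.mem_univ j)]
      congr 1
      · refine Finset.prod_congr rfl fun l hl => ?_
        rw [Function.update_of_ne (Finset.ne_of_mem_erase hl)]
      · simp
    rw [this, ← Finset.prod_erase_mul _ _ (Finset.mem_univ j),
      ((hasDerivAt_zpow (E k j) (u j) (Or.inl (hu j))).const_mul _).deriv,
      zpow_sub_one₀ (hu j)]
    simp
    ring
  have hc : canonicalForm i' (lift i u).1 = (∏ k, coord i' k (lift i u).1) * ∏ j, (u j)⁻¹ := by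
    have hz : ∀ ρ, (lift i u).1 ρ ≠ 0 := by
      intro ρ
      change (∏ j, if cone i j = ρ then u j else 1) ≠ 0
      exact Finset.prod_ne_zero_iff.2 fun j _ => by split_ifs <;> simp [hu]
    have h1 : ∏ ρ, (lift i u).1 ρ = ∏ j, u j := by
      rw [← Finset.prod_subset (Finset.subset_univ (Finset.univ.image (cone i))),
    Finset.prod_image (fun a _ b _ h => cone_injective i h)]
      · simp [lift_cone]
      · intro ρ _ h
        rw [lift_off]
        simpa using h
    rw [Finset.prod_inv_distrib, ← h1, ← Finset.prod_inv_distrib]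
    simp only [canonicalForm, coord]
    rw [Finset.prod_comm, ← Finset.prod_mul_distrib]
    refine Finset.prod_congr rfl fun ρ _ => ?_
    rw [zpow_sub_one₀ (hz ρ)]
    congr 1
    simp [Fin.sum_univ_succ, Fin.prod_univ_succ, zpow_add₀ (hz ρ)]
  have hn : ‖(E.map (Int.castRingHom K)).det‖ = 1 := by
    rw [← RingHom.mapMatrix_apply, ← RingHom.map_det]
    rcases Int.isUnit_iff.1 hdE with h | h <;> simp [h]
  rw [canonicalForm_lift, norm_one, mul_one, hd, Matrix.det_mul,
    Matrix.det_mul, Matrix.det_diagonal, Matrix.det_diagonal,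
    norm_mul, norm_mul, hn, mul_one, hc, norm_mul]

instance : TopologicalSpace (Y K) := instTopologicalSpaceSubtype

/-- The analytic topology on `X(K)`. -/
instance : TopologicalSpace (X K) := instTopologicalSpaceQuotient

instance : MeasurableSpace (X K) := borel (X K)

instance : BorelSpace (X K) := ⟨rfl⟩

variable [MeasurableSpace K] (μ : Measure K)

/-- The measure `τ_{(X,D)}` on `X(K)`, for a fixed Haar measure `μ` on `K`: in local coordinates,
`dτ = du₀ du₁ du₂ / ‖1_D ⊗ du₀ ∧ du₁ ∧ du₂‖`.  The local measures are glued by using the `i`-th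
chart outside the union of the previous ones. -/
def logTamagawaMeasure : Measure (X K) :=
  ∑ i : Fin 12, Measure.map (param i)
    (((Measure.pi fun _ : Fin 3 => μ).withDensity fun u =>
        (ENNReal.ofReal (formNorm i u))⁻¹).restrict
      {u | ∀ i' < i, param i u ∉ chart i'})

/-- The measure `τ_U`, the restriction of `τ_{(X,D)}` to `U(K)`. -/
def tamagawaU : Measure (X K) := (logTamagawaMeasure μ).restrict (U K)

/-- The measure `τ_{(M, E₁ + E₂)} = ‖1_{E₁ + E₂}‖⁻¹ τ_M` on `M(K)`, as a measure on `X(K)`: in local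
coordinates, `dτ = dv₀ dv₁ / ‖1_{E₁ + E₂} ⊗ dv₀ ∧ dv₁‖`.  The charts of `M` are those of `X` that
meet `M`, glued as above; in each of them, `M` is given by the vanishing of the first
coordinate. -/
def tamagawaM : Measure (X K) :=
  ∑ i : Fin 12 with cone i 0 = a₀, Measure.map (fun v : Fin 2 → K => param i (Fin.cons 0 v))
    (((Measure.pi fun _ : Fin 2 => μ).withDensity fun v =>
        (ENNReal.ofReal (residueFormNorm i v))⁻¹).restrict
      {v | ∀ i' < i, param i (Fin.cons 0 v) ∉ chart i'})

end Measures

/-- The residue measure `τ_{M,∞}` on `M(ℝ)`: the measure `τ_{(M, E₁ + E₂), ∞}`, renormalized by the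
factor `c_ℝ ^ #{M} = c_ℝ`, where `c_ℝ = vol [-1, 1] = 2`. -/
def residueMeasureM : Measure (X ℝ) :=
  volume (Metric.closedBall (0 : ℝ) 1) • tamagawaM (volume : Measure ℝ)

instance (p : ℕ) [Fact p.Prime] : MeasurableSpace ℚ_[p] := borel _

instance (p : ℕ) [Fact p.Prime] : BorelSpace ℚ_[p] := ⟨rfl⟩

/-- The Haar measure on `ℚ_p` normalized by `μ(ℤ_p) = 1`. -/
def padicHaar (p : ℕ) [Fact p.Prime] : Measure ℚ_[p] :=
  Measure.addHaarMeasure ⟨⟨Metric.closedBall 0 1, isCompact_closedBall _ _⟩,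
    ⟨0, mem_interior_iff_mem_nhds.2 (Metric.closedBall_mem_nhds _ one_pos)⟩⟩

end ToricThreefold

end

/-! All the measures can be computed on the chart of the cone spanned by $a_0,b_0,c_0$, with
coordinates $a=a_0/(a_1xy)$, $b=b_0/(b_1x)$, $c=c_0/(c_1y)$. A point of another chart that misses
this one has a vanishing local coordinate, so such points form a null set; the same holds on $M$
(`logTamagawaMeasure_eq_map`, `tamagawaM_eq_map`).

On this chart the norm of $1_D\otimes da\wedge db\wedge dc$ is
$|a|\cdot\max(\max(1,|b|^2)\max(1,|c|^2),|a|^2)/\max(1,|a|)$ (`formNorm_zero`). Dividing by $|a|$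
and letting $a\to0$ leaves $\max(1,|b|^2)\max(1,|c|^2)$ (`residueFormNorm_zero`). Hence the volume
of $M(\mathbb R)$ is the square of $\int dt/\max(1,t^2)=4$, and the factor $c_{\mathbb R}=2$ gives
$32$.

At $p$, the integral points of the chart are those with $|a|=1$, or with $|a|>1$ and $b,c\in\mathbb
Z_p$ (`param_zero_mem_integralPoints_iff`). In particular they stay away from $a=0$, where the
density is infinite. For $|a|=1$ the density is $1/(\max(1,|b|^2)\max(1,|c|^2))$, with integral
$(1-1/p)(1+1/p)^2$; in the other case it is $|a|^{-2}$, with integral $1/p$. The sum is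
$1+2/p-1/p^2-1/p^3$. -/

open Filter MeasureTheory Topology
open scoped LinearAlgebra.Projectivization ENNReal

namespace ToricThreefold

open Ray

/-! ### Divisors, charts and $U$ in terms of Cox coordinates -/

section Points

variable {K : Type*} [Field K]

theorem toX_eq_iff {z w : Y K} : toX z = toX w ↔ ∃ t : Fin 5 → Kˣ, t • w = z :=
  Quotient.eq (r := MulAction.orbitRel (Fin 5 → Kˣ) (Y K))

/-- Characters take invertible values, so whether a Cox coordinate vanishes depends only on the
orbit. Membership in divisors and charts can thus be tested on any representative. -/
theorem smul_coord_eq_zero_iff (t : Fin 5 → Kˣ) (z : Y K) (ρ : Ray) :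
    (t • z).1 ρ = 0 ↔ z.1 ρ = 0 := by
  change (character (degree ρ) t : K) * z.1 ρ = 0 ↔ _
  simp

theorem toX_mem_divisor {z : Y K} {ρ : Ray} : toX z ∈ divisor ρ ↔ z.1 ρ = 0 := by
  constructor
  · rintro ⟨w, hw, h⟩
    obtain ⟨t, rfl⟩ := toX_eq_iff.1 hw
    exact (smul_coord_eq_zero_iff t z ρ).1 h
  · exact fun h => ⟨z, rfl, h⟩

theorem toX_mem_chart {z : Y K} {i : Fin 12} :
    toX z ∈ chart i ↔ ∀ ρ, (∀ j, cone i j ≠ ρ) → z.1 ρ ≠ 0 := by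
  constructor
  · rintro ⟨w, hw, h⟩ ρ hρ
    obtain ⟨t, rfl⟩ := toX_eq_iff.1 hw
    exact fun h0 => h ρ hρ ((smul_coord_eq_zero_iff t z ρ).2 h0)
  · exact fun h => ⟨z, rfl, h⟩

theorem toX_mem_U {z : Y K} : toX z ∈ U K ↔ z.1 a₀ ≠ 0 ∧ z.1 x ≠ 0 ∧ z.1 y ≠ 0 := by
  simp only [U, M, Set.mem_compl_iff, Set.mem_union, toX_mem_divisor]
  tauto

/-- Such a point lies in the open torus, which every chart contains. -/
theorem param_mem_chart {i : Fin 12} {u : Fin 3 → K} (hu : ∀ j, u j ≠ 0) (i' : Fin 12) :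
    param i u ∈ chart i' := by
  refine toX_mem_chart.2 fun ρ _ => ?_
  change ∏ j, (if cone i j = ρ then u j else 1) ≠ 0
  refine Finset.prod_ne_zero_iff.2 fun j _ => ?_
  split_ifs
  exacts [hu j, one_ne_zero]

/-- Only $a_0$ vanishes at such a point, and $a_0$ is a ray of the first cone. -/
theorem param_cons_zero_mem_chart_zero {i : Fin 12} (hi : cone i 0 = a₀) {v : Fin 2 → K}
    (hv : ∀ j, v j ≠ 0) : param i (Fin.cons 0 v) ∈ chart 0 := by
  refine toX_mem_chart.2 fun ρ hρ => ?_
  change ∏ j, (if cone i j = ρ then (Fin.cons 0 v : Fin 3 → K) j else 1) ≠ 0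
  refine Finset.prod_ne_zero_iff.2 fun j _ => ?_
  refine Fin.cases ?_ (fun j => ?_) j
  · have : a₀ ≠ ρ := hρ 0
    simp [hi, this]
  · split_ifs
    exacts [hv j, one_ne_zero]

theorem lift_zero_apply (u : Fin 3 → K) : (lift 0 u).1 a₀ = u 0 ∧ (lift 0 u).1 a₁ = 1 ∧
    (lift 0 u).1 b₀ = u 1 ∧ (lift 0 u).1 b₁ = 1 ∧ (lift 0 u).1 c₀ = u 2 ∧
    (lift 0 u).1 c₁ = 1 ∧ (lift 0 u).1 x = 1 ∧ (lift 0 u).1 y = 1 :=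
  ⟨lift_cone 0 0 u, lift_off _ _ _ (by decide), lift_cone 0 1 u, lift_off _ _ _ (by decide),
    lift_cone 0 2 u, lift_off _ _ _ (by decide), lift_off _ _ _ (by decide),
    lift_off _ _ _ (by decide)⟩

end Points

/-! ### The metrics on the first chart -/

section Norm

variable {K : Type*}

theorem ciSup_fin_two_eq_max (f : Fin 2 → ℝ) : ⨆ k, f k = max (f 0) (f 1) :=
  have h := (Set.finite_range f).bddAbove
  le_antisymm (ciSup_le fun k => by fin_cases k <;> simp) (max_le (le_ciSup h 0) (le_ciSup h 1))

theorem ciSup_fin_five_eq_max (f : Fin 5 → ℝ) :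
    ⨆ k, f k = max (max (max (f 0) (f 1)) (max (f 2) (f 3))) (f 4) :=
  have h := (Set.finite_range f).bddAbove
  le_antisymm (ciSup_le fun k => by fin_cases k <;> simp)
    (max_le (max_le (max_le (le_ciSup h 0) (le_ciSup h 1)) (max_le (le_ciSup h 2) (le_ciSup h 3)))
      (le_ciSup h 4))

/-- At $(a:1:b:1:c:1:1:1)$ the five sections of $\mathcal L_1$ are $b^2c^2,c^2,b^2,1,a^2$, and the
first four have maximum $\max(1,|b|^2)\max(1,|c|^2)$. The denominator comes from $\mathcal L_2$ and
the factor $|a|$ from $1_D$. -/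
theorem formNorm_zero [NormedField K] (u : Fin 3 → K) : formNorm 0 u =
    ‖u 0‖ * (max (max 1 (‖u 1‖ ^ 2) * max 1 (‖u 2‖ ^ 2)) (‖u 0‖ ^ 2) / max 1 ‖u 0‖) := by
  obtain ⟨h1, h2, h3, h4, h5, h6, h7, h8⟩ := lift_zero_apply u
  have e : max (max (‖u 1‖ ^ 2 * ‖u 2‖ ^ 2) (‖u 2‖ ^ 2)) (max (‖u 1‖ ^ 2) 1) =
      max 1 (‖u 1‖ ^ 2) * max 1 (‖u 2‖ ^ 2) := by
    rw [max_mul_of_nonneg _ _ (by positivity), mul_max_of_nonneg _ _ (by positivity),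
      mul_max_of_nonneg _ _ (by positivity)]
    simp only [mul_one, one_mul]
    ac_rfl
  simp only [formNorm, logCanonicalNorm, logAnticanonicalNorm, sectionNorm, canonicalForm_lift,
    oneD, ciSup_fin_two_eq_max, ciSup_fin_five_eq_max]
  simp only [sections₁, sections₂, Matrix.cons_val, map_mul, map_pow, MvPolynomial.aeval_X, h1, h2,
    h3, h4, h5, h6, h7, h8, one_pow, mul_one, one_mul, norm_mul, norm_pow, norm_one, e]
  rw [max_comm 1 ‖u 0‖]
  simp only [one_mul, div_eq_mul_inv, mul_inv_rev, inv_inv, mul_comm]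

theorem residueFormNorm_zero [NontriviallyNormedField K] (v : Fin 2 → K) :
    residueFormNorm 0 v = max 1 (‖v 0‖ ^ 2) * max 1 (‖v 1‖ ^ 2) := by
  refine Tendsto.limUnder_eq ?_
  set A := max 1 (‖v 0‖ ^ 2) * max 1 (‖v 1‖ ^ 2) with hA
  have h1 : (1 : ℝ) ≤ A := by
    rw [hA]; exact one_le_mul_of_one_le_of_one_le (le_max_left _ _) (le_max_left _ _)
  have hc : Continuous fun t : K => max A (‖t‖ ^ 2) / max 1 ‖t‖ :=
    Continuous.div (by fun_prop) (by fun_prop)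
      fun t => (lt_of_lt_of_le one_pos (le_max_left _ _)).ne'
  have h0 := (hc.tendsto 0).mono_left (nhdsWithin_le_nhds (s := {0}ᶜ))
  have e : max A (‖(0 : K)‖ ^ 2) / max 1 ‖(0 : K)‖ = A := by
    simp [max_eq_left (zero_le_one.trans h1)]
  rw [e] at h0
  refine h0.congr' ?_
  filter_upwards [self_mem_nhdsWithin] with t ht
  have ht : ‖t‖ ≠ 0 := norm_ne_zero_iff.2 ht
  rw [formNorm_zero, norm_inv]
  change _ = ‖t‖⁻¹ * (‖t‖ * (max A (‖t‖ ^ 2) / max 1 ‖t‖))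
  rw [inv_mul_cancel_left₀ ht]

end Norm

/-! ### The analytic topology on $X(K)$ -/

section Topology

variable {K : Type*} [NontriviallyNormedField K]

theorem continuous_Y_coord (ρ : Ray) : Continuous fun z : Y K => z.1 ρ :=
  (continuous_apply ρ).comp continuous_subtype_val

theorem continuous_param (i : Fin 12) : Continuous (param i : (Fin 3 → K) → X K) := by
  refine continuous_quotient_mk'.comp ?_
  refine Continuous.subtype_mk (continuous_pi fun ρ => ?_) _
  refine continuous_finsetProd _ fun j _ => ?_
  split_ifs
  exacts [continuous_apply j, continuous_const]

theorem isOpen_X_iff {s : Set (X K)} : IsOpen s ↔ IsOpen {z : Y K | toX z ∈ s} := Iff.rfl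

theorem isClosed_divisor (ρ : Ray) : IsClosed (divisor ρ : Set (X K)) := by
  rw [← isOpen_compl_iff, isOpen_X_iff]
  simp only [Set.mem_compl_iff, toX_mem_divisor]
  exact isOpen_ne_fun (continuous_Y_coord ρ) continuous_const

end Topology

/-! ### Integral points of the model -/

section Padic

variable {p : ℕ} [hp : Fact p.Prime]

/-- $\mathbb Z_p$ is local: if $sa+tb=1$, one of the summands is a unit. -/
theorem isCoprime_padicInt_iff (a b : ℤ_[p]) : IsCoprime a b ↔ ‖a‖ = 1 ∨ ‖b‖ = 1 := by
  rw [← PadicInt.isUnit_iff, ← PadicInt.isUnit_iff]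
  constructor
  · rintro ⟨s, t, h⟩
    rcases IsLocalRing.isUnit_or_isUnit_of_add_one h with h | h
    exacts [Or.inl (isUnit_of_mul_isUnit_right h), Or.inr (isUnit_of_mul_isUnit_right h)]
  · rintro (h | h)
    · obtain ⟨s, hs⟩ := h.exists_left_inv
      exact ⟨s, 0, by simp [hs]⟩
    · obtain ⟨s, hs⟩ := h.exists_left_inv
      exact ⟨0, s, by simp [hs]⟩

/-- Primitive homogeneous coordinates of a point of `ℙ¹(ℚ_p)`. -/
def IsPrimitiveFor (a : Fin 2 → ℤ_[p]) (u : Fin 2 → ℚ_[p]) : Prop :=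
  IsCoprime (a 0) (a 1) ∧ ∃ t : ℚ_[p], t ≠ 0 ∧ ∀ k, u k = t * a k

theorem exists_isPrimitiveFor {u : Fin 2 → ℚ_[p]} (hu : u ≠ 0) :
    ∃ a, IsPrimitiveFor a u := by
  -- Dividing by a coordinate of maximal norm makes all coordinates integral and one of them $1$.
  obtain ⟨i, hi⟩ : ∃ i, ∀ k, ‖u k‖ ≤ ‖u i‖ := Finite.exists_max fun k => ‖u k‖
  have hi0 : u i ≠ 0 := by
    intro h0
    refine hu (funext fun k => ?_)
    have := hi k
    rw [h0, norm_zero] at this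
    exact norm_le_zero_iff.1 this
  have hle : ∀ k, ‖u k / u i‖ ≤ 1 := fun k => by
    rw [norm_div]
    exact div_le_one_of_le₀ (hi k) (norm_nonneg _)
  obtain ⟨a, ha⟩ : ∃ a : Fin 2 → ℤ_[p], ∀ k, (a k : ℚ_[p]) = u k / u i :=
    ⟨fun k => ⟨u k / u i, hle k⟩, fun _ => rfl⟩
  have h1 : ‖a i‖ = 1 := by rw [PadicInt.norm_def, ha, div_self hi0, norm_one]
  refine ⟨a, ?_, u i, hi0, fun k => ?_⟩
  · rw [isCoprime_padicInt_iff]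
    fin_cases i
    exacts [Or.inl h1, Or.inr h1]
  · rw [ha, mul_div_cancel₀ _ hi0]

namespace IsPrimitiveFor

variable {a : Fin 2 → ℤ_[p]} {u : Fin 2 → ℚ_[p]}

theorem ne_zero (h : IsPrimitiveFor a u) : (fun k => (a k : ℚ_[p])) ≠ 0 := by
  intro h0
  have := (isCoprime_padicInt_iff _ _).1 h.1
  have h1 := congrFun h0 0
  have h2 := congrFun h0 1
  simp only [Pi.zero_apply] at h1 h2
  rw [PadicInt.norm_def, PadicInt.norm_def, h1, h2] at this
  simp at this

/-- The ratio $u_j/u_i$ equals $a_j/a_i$. As one of $a_i,a_j$ is a unit, this ratio is integral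
exactly when $a_i$ is one. -/
theorem norm_eq_one_iff (h : IsPrimitiveFor a u) (i j : Fin 2) (hij : i ≠ j) :
    ‖a i‖ = 1 ↔ u i ≠ 0 ∧ ‖u j / u i‖ ≤ 1 := by
  obtain ⟨hc, t, ht, hu⟩ := h
  have ht' := norm_pos_iff.2 ht
  rw [isCoprime_padicInt_iff] at hc
  have hc' : ‖a i‖ = 1 ∨ ‖a j‖ = 1 := by
    fin_cases i <;> fin_cases j <;> simp at hij hc ⊢ <;> tauto
  rw [hu i, hu j, mul_div_mul_left _ _ ht, norm_div, PadicInt.padic_norm_e_of_padicInt,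
    PadicInt.padic_norm_e_of_padicInt]
  constructor
  · intro h1
    refine ⟨mul_ne_zero ht ?_, ?_⟩
    · intro h0
      rw [PadicInt.norm_def, h0] at h1
      simp at h1
    · rw [h1, div_one]; exact PadicInt.norm_le_one _
  · rintro ⟨h0, h1⟩
    rcases hc' with h | h
    · exact h
    · rw [h] at h1
      have h2 : 0 < ‖a i‖ := by
        rw [norm_pos_iff]; rintro h; simp [h] at h0
      rw [div_le_one h2] at h1
      exact le_antisymm (PadicInt.norm_le_one _) h1

theorem norm_one_of_norm_zero (h : IsPrimitiveFor a u) (h0 : ‖a 0‖ = 1) : ‖a 1‖ = ‖u 1 / u 0‖ := by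
  obtain ⟨hc, t, ht, hu⟩ := h
  rw [hu 0, hu 1, mul_div_mul_left _ _ ht, norm_div, PadicInt.padic_norm_e_of_padicInt,
    PadicInt.padic_norm_e_of_padicInt, h0, div_one]

end IsPrimitiveFor

theorem mk_eq_mk_coe_iff {u : Fin 2 → ℚ_[p]} (hu : u ≠ 0) {a : Fin 2 → ℤ_[p]}
    (ha : (fun k => (a k : ℚ_[p])) ≠ 0) :
    Projectivization.mk ℚ_[p] u hu = Projectivization.mk ℚ_[p] _ ha ↔
      ∃ t : ℚ_[p], t ≠ 0 ∧ ∀ k, u k = t * a k := by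
  rw [Projectivization.mk_eq_mk_iff]
  constructor
  · rintro ⟨t, ht⟩
    exact ⟨t, t.ne_zero, fun k => (congrFun ht k).symm⟩
  · rintro ⟨t, ht, h⟩
    exact ⟨Units.mk0 t ht, funext fun k => (h k).symm⟩

/-- The open condition cutting out `𝔘(ℤ_p)` in terms of `a₁xy / a₀`, `b₀ : b₁x` and `c₀ : c₁y`. -/
theorem mk_mem_integralModel_iff {u v w : Fin 2 → ℚ_[p]} (hu : u ≠ 0) (hv : v ≠ 0) (hw : w ≠ 0) :
    ((Projectivization.mk ℚ_[p] u hu, Projectivization.mk ℚ_[p] v hv,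
      Projectivization.mk ℚ_[p] w hw) : X₀ ℚ_[p]) ∈ integralModel p ↔
    (u 0 ≠ 0 ∧ ‖u 1 / u 0‖ ≤ 1) ∧
      (‖u 1 / u 0‖ = 1 ∨ (v 1 ≠ 0 ∧ ‖v 0 / v 1‖ ≤ 1)) ∧
      (‖u 1 / u 0‖ = 1 ∨ (w 1 ≠ 0 ∧ ‖w 0 / w 1‖ ≤ 1)) := by
  have key : ∀ {a b c : Fin 2 → ℤ_[p]}, IsPrimitiveFor a u → IsPrimitiveFor b v →
      IsPrimitiveFor c w → ((IsUnit (a 0) ∧ IsCoprime (a 1) (b 1) ∧ IsCoprime (a 1) (c 1)) ↔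
      (u 0 ≠ 0 ∧ ‖u 1 / u 0‖ ≤ 1) ∧
      (‖u 1 / u 0‖ = 1 ∨ (v 1 ≠ 0 ∧ ‖v 0 / v 1‖ ≤ 1)) ∧
      (‖u 1 / u 0‖ = 1 ∨ (w 1 ≠ 0 ∧ ‖w 0 / w 1‖ ≤ 1))) := by
    intro a b c ha hb hc
    rw [isCoprime_padicInt_iff, isCoprime_padicInt_iff, PadicInt.isUnit_iff,
      ← ha.norm_eq_one_iff 0 1 (by decide), ← hb.norm_eq_one_iff 1 0 (by decide),
      ← hc.norm_eq_one_iff 1 0 (by decide)]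
    -- Once $a_0$ is a unit, $|a_1|=|u_1/u_0|$, so "$a_1$ is a unit" becomes a condition on $u$
    -- alone.
    refine and_congr_right fun h0 => ?_
    rw [ha.norm_one_of_norm_zero h0]
  constructor
  · rintro ⟨a, b, c, ha, hb, hc, h, ca, cb, cc, h'⟩
    simp only [Prod.mk.injEq, mk_eq_mk_coe_iff] at h
    exact (key ⟨ca, h.1⟩ ⟨cb, h.2.1⟩ ⟨cc, h.2.2⟩).1 h'
  · intro h
    obtain ⟨a, ha⟩ := exists_isPrimitiveFor hu
    obtain ⟨b, hb⟩ := exists_isPrimitiveFor hv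
    obtain ⟨c, hc⟩ := exists_isPrimitiveFor hw
    refine ⟨a, b, c, ha.ne_zero, hb.ne_zero, hc.ne_zero, ?_, ha.1, hb.1, hc.1,
      (key ha hb hc).2 h⟩
    rw [(mk_eq_mk_coe_iff hu ha.ne_zero).2 ha.2, (mk_eq_mk_coe_iff hv hb.ne_zero).2 hb.2,
      (mk_eq_mk_coe_iff hw hc.ne_zero).2 hc.2]

theorem toX_mem_integralPoints_iff {z : Y ℚ_[p]} : toX z ∈ integralPoints p ↔
    (z.1 a₀ ≠ 0 ∧ z.1 x ≠ 0 ∧ z.1 y ≠ 0) ∧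
    (z.1 a₀ ≠ 0 ∧ ‖z.1 a₁ * z.1 x * z.1 y / z.1 a₀‖ ≤ 1) ∧
    (‖z.1 a₁ * z.1 x * z.1 y / z.1 a₀‖ = 1 ∨
      (z.1 b₁ * z.1 x ≠ 0 ∧ ‖z.1 b₀ / (z.1 b₁ * z.1 x)‖ ≤ 1)) ∧
    (‖z.1 a₁ * z.1 x * z.1 y / z.1 a₀‖ = 1 ∨
      (z.1 c₁ * z.1 y ≠ 0 ∧ ‖z.1 c₀ / (z.1 c₁ * z.1 y)‖ ≤ 1)) := by
  exact and_congr toX_mem_U (mk_mem_integralModel_iff z.a_ne z.b_ne z.c_ne)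

theorem isOpen_norm_div_mem {Z : Type*} [TopologicalSpace Z] {f g : Z → ℚ_[p]} (hf : Continuous f)
    (hg : Continuous g) {s : Set ℚ_[p]} (hs : IsOpen s) :
    IsOpen {z | g z ≠ 0 ∧ f z / g z ∈ s} := by
  have h : ContinuousOn (fun z => f z / g z) {z | g z ≠ 0} :=
    hf.continuousOn.div hg.continuousOn fun _ h => h
  exact h.isOpen_inter_preimage (isOpen_ne_fun hg continuous_const) hs

/-- This supplies measurability. The closed unit ball and the unit sphere of $\mathbb Q_p$ are open,
and openness in the quotient topology is checked on the torsor. -/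
theorem isOpen_integralPoints : IsOpen (integralPoints p) := by
  have hle : IsOpen {q : ℚ_[p] | ‖q‖ ≤ 1} := by
    simpa [Metric.closedBall] using IsUltrametricDist.isOpen_closedBall (0 : ℚ_[p]) one_ne_zero
  have heq : IsOpen {q : ℚ_[p] | ‖q‖ = 1} := by
    simpa [Metric.sphere] using IsUltrametricDist.isOpen_sphere (0 : ℚ_[p]) one_ne_zero
  have hc := @continuous_Y_coord ℚ_[p] _
  have ha := ((hc a₁).mul (hc x)).mul (hc y)
  have hA := isOpen_norm_div_mem ha (hc a₀) hle
  have hA' := isOpen_norm_div_mem ha (hc a₀) heq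
  have hB := isOpen_norm_div_mem (hc b₀) ((hc b₁).mul (hc x)) hle
  have hC := isOpen_norm_div_mem (hc c₀) ((hc c₁).mul (hc y)) hle
  have hx := isOpen_ne_fun (hc x) (continuous_const (y := 0))
  have hy := isOpen_ne_fun (hc y) (continuous_const (y := 0))
  rw [isOpen_X_iff]
  convert ((hx.inter hy).inter hA).inter ((hA'.union hB).inter (hA'.union hC)) using 1
  ext z
  simp only [Set.mem_ofPred_eq, toX_mem_integralPoints_iff, Set.mem_inter_iff, Set.mem_union]
  tauto

/-- Here $a_1xy/a_0=1/a$, so avoiding $V(a_0)$ modulo $p$ means $|a|\ge1$. If $|a|=1$, the reduction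
also avoids $a_1=0$, hence both lines. If $|a|>1$, it lies on $a_1=0$ and must avoid $b_1=0$ and
$c_1=0$, that is, $b$ and $c$ are integral. -/
theorem param_zero_mem_integralPoints_iff {u : Fin 3 → ℚ_[p]} :
    param 0 u ∈ integralPoints p ↔ ‖u 0‖ = 1 ∨ (1 < ‖u 0‖ ∧ ‖u 1‖ ≤ 1 ∧ ‖u 2‖ ≤ 1) := by
  obtain ⟨h1, h2, h3, h4, h5, h6, h7, h8⟩ := lift_zero_apply u
  change toX _ ∈ _ ↔ _
  rw [toX_mem_integralPoints_iff, h1, h2, h3, h4, h5, h6, h7, h8]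
  by_cases h0 : u 0 = 0
  · simp [h0]
  · have : 0 < ‖u 0‖ := norm_pos_iff.2 h0
    simp only [mul_one, norm_div, norm_one, ne_eq, one_ne_zero, not_false_eq_true, true_and,
      and_true, h0, div_le_one this, div_eq_one_iff_eq this.ne', div_one]
    rw [eq_comm (a := (1 : ℝ)), le_iff_eq_or_lt, eq_comm (a := (1 : ℝ))]
    grind

end Padic

/-- **Tonelli's theorem** for a product of functions of the individual coordinates. -/
theorem lintegral_fin_prod_eq_prod {n : ℕ} {E : Type*} [MeasurableSpace E] (μ : Measure E)
    [SigmaFinite μ] (f : Fin n → E → ℝ≥0∞) (hf : ∀ i, Measurable (f i)) :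
    ∫⁻ x : Fin n → E, ∏ i, f i (x i) ∂(Measure.pi fun _ => μ) = ∏ i, ∫⁻ x, f i x ∂μ := by
  induction n with
  | zero => simp
  | succ n ih =>
    have h := ((measurePreserving_piFinSuccAbove (fun _ : Fin (n + 1) => μ) 0).symm)
    have hm : Measurable fun x : Fin n → E => ∏ i, f (Fin.succ i) (x i) :=
      Finset.measurable_prod _ fun i _ => (hf _).comp (measurable_pi_apply i)
    have hm' : Measurable fun x : Fin (n + 1) → E => ∏ i, f i (x i) :=
      Finset.measurable_prod _ fun i _ => (hf i).comp (measurable_pi_apply i)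
    rw [← h.lintegral_comp hm', Fin.prod_univ_succ,
      ← ih (fun i => f i.succ) fun i => hf i.succ]
    simp only [MeasurableEquiv.piFinSuccAbove_symm_apply, Fin.insertNthEquiv,
      Fin.prod_univ_succ, Equiv.coe_fn_mk, Fin.insertNth_zero, Fin.cons_succ,
      Fin.zero_succAbove, cast_eq, Fin.cons_zero]
    exact lintegral_prod_mul (hf 0).aemeasurable hm.aemeasurable

theorem pi_iUnion_hyperplane_eq_zero {n : ℕ} {E : Type*} [MeasurableSpace E] [Zero E]
    (μ : Measure E) [SigmaFinite μ] [NullSingletonClass μ] {s : Set (Fin n → E)}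
    (hs : ∀ u ∈ s, ∃ j, u j = 0) : (Measure.pi fun _ => μ) s = 0 :=
  measure_mono_null (fun u hu => Set.mem_iUnion.2 (hs u hu))
    (measure_iUnion_null fun j => Measure.pi_hyperplane (fun _ => μ) j 0)

theorem withDensity_restrict_eq_zero {E : Type*} [MeasurableSpace E] {μ : Measure E}
    {f : E → ℝ≥0∞} {s : Set E} (hs : μ s = 0) : (μ.withDensity f).restrict s = 0 :=
  Measure.restrict_eq_zero.2 (withDensity_absolutelyContinuous μ f hs)

/-! ### Reduction of the measures to the first chart -/

section Charts

variable {K : Type*} [NontriviallyNormedField K] [MeasurableSpace K]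

/-- The complement of the first chart is a null set for `τ_{(X,D)}`. -/
theorem logTamagawaMeasure_eq_map (μ : Measure K) [SigmaFinite μ] [NullSingletonClass μ] :
    logTamagawaMeasure μ = Measure.map (param 0)
    ((Measure.pi fun _ : Fin 3 => μ).withDensity fun u => (ENNReal.ofReal (formNorm 0 u))⁻¹) := by
  rw [logTamagawaMeasure, Finset.sum_eq_single 0]
  · simp
  · intro i _ hi
    rw [withDensity_restrict_eq_zero, Measure.map_zero]
    -- The $i$-th piece omits all earlier charts, in particular the first, and therefore every point
    -- off the coordinate hyperplanes.
    refine pi_iUnion_hyperplane_eq_zero μ fun u hu => ?_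
    by_contra! h
    exact hu 0 (Fin.pos_iff_ne_zero.2 hi) (param_mem_chart h 0)
  · simp

/-- The complement of the first chart is a null set for `τ_{(M, E₁ + E₂)}`. -/
theorem tamagawaM_eq_map (μ : Measure K) [SigmaFinite μ] [NullSingletonClass μ] :
    tamagawaM μ = Measure.map (fun v : Fin 2 → K => param 0 (Fin.cons 0 v))
    ((Measure.pi fun _ : Fin 2 => μ).withDensity fun v =>
      (ENNReal.ofReal (residueFormNorm 0 v))⁻¹) := by
  rw [tamagawaM, Finset.sum_eq_single 0]
  · simp
  · intro i hi0 hi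
    rw [withDensity_restrict_eq_zero, Measure.map_zero]
    refine pi_iUnion_hyperplane_eq_zero μ fun u hu => ?_
    by_contra! h
    exact hu 0 (Fin.pos_iff_ne_zero.2 hi)
      (param_cons_zero_mem_chart_zero (Finset.mem_filter.1 hi0).2 h)
  · intro h
    exact absurd (by simp [cone]) h

/-- The density of the Tamagawa measure of `ℙ¹` with respect to the Haar measure `μ`. -/
noncomputable def lineDensity (t : K) : ℝ≥0∞ := ENNReal.ofReal (max 1 (‖t‖ ^ 2))⁻¹

theorem measurable_lineDensity [BorelSpace K] : Measurable (lineDensity : K → ℝ≥0∞) := by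
  unfold lineDensity
  fun_prop

/-- The residue density is a product of two one-variable densities and the chart $a=0$ maps into
$M$, so Tonelli gives a square. -/
theorem tamagawaM_M [BorelSpace K] [SecondCountableTopology K] (μ : Measure K) [SigmaFinite μ]
    [NullSingletonClass μ] : tamagawaM μ (M K) = (∫⁻ t, lineDensity t ∂μ) ^ 2 := by
  have hp : Continuous fun v : Fin 2 → K => (param 0 (Fin.cons 0 v) : X K) := by
    refine (continuous_param 0).comp (continuous_pi fun j => ?_)
    refine Fin.cases ?_ (fun j => ?_) j
    · exact continuous_const
    · simpa using continuous_apply j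
  have hM : (fun v : Fin 2 → K => (param 0 (Fin.cons 0 v) : X K)) ⁻¹' M K = Set.univ := by
    refine Set.eq_univ_of_forall fun v => toX_mem_divisor.2 ?_
    rw [(lift_zero_apply _).1, Fin.cons_zero]
  have hMm : MeasurableSet (M K) := (isClosed_divisor a₀).measurableSet
  rw [tamagawaM_eq_map, Measure.map_apply hp.measurable hMm, hM,
    withDensity_apply _ MeasurableSet.univ, Measure.restrict_univ]
  have := lintegral_fin_prod_eq_prod μ (fun _ : Fin 2 => lineDensity) fun _ => measurable_lineDensity
  rw [Finset.prod_const, Finset.card_univ, Fintype.card_fin] at this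
  rw [← this]
  refine lintegral_congr fun v => ?_
  have h0 : ∀ t : K, 0 < max 1 (‖t‖ ^ 2) := fun t => lt_of_lt_of_le one_pos (le_max_left _ _)
  rw [residueFormNorm_zero, Fin.prod_univ_two, lineDensity, lineDensity,
    ← ENNReal.ofReal_mul (inv_nonneg.2 (h0 _).le), ← mul_inv,
    ENNReal.ofReal_inv_of_pos (mul_pos (h0 _) (h0 _))]

end Charts

/-! ### The real integral: $2$ from $[-1,1]$ and $1$ from each tail -/

theorem lintegral_lineDensity_real : ∫⁻ t : ℝ, lineDensity t = 4 := by
  have hIoi : ∫⁻ t in Set.Ioi (1 : ℝ), lineDensity t = 1 := by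
    have h1 := integral_Ioi_rpow_of_lt (a := -2) (by norm_num) one_pos
    have h2 := integrableOn_Ioi_rpow_of_lt (a := -2) (by norm_num) one_pos
    rw [Real.one_rpow, show -(1 : ℝ) / (-2 + 1) = 1 by norm_num] at h1
    have h3 : ENNReal.ofReal (∫ t in Set.Ioi (1 : ℝ), t ^ (-2 : ℝ)) = 1 := by
      rw [h1, ENNReal.ofReal_one]
    rw [← h3, ofReal_integral_eq_lintegral_ofReal h2]
    · refine setLIntegral_congr_fun measurableSet_Ioi fun t ht => ?_
      have ht : (1 : ℝ) < t := ht
      have ht0 : 0 < t := one_pos.trans ht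
      rw [lineDensity, max_eq_right (by rw [Real.norm_of_nonneg ht0.le]; nlinarith),
        Real.norm_of_nonneg ht0.le, Real.rpow_neg ht0.le]
      norm_num
    · filter_upwards [ae_restrict_mem measurableSet_Ioi] with t ht
      exact Real.rpow_nonneg (one_pos.trans ht).le _
  have hIio : ∫⁻ t in Set.Iio (-1 : ℝ), lineDensity t = 1 := by
    rw [← hIoi, ← (Measure.measurePreserving_neg (volume : Measure ℝ)).setLIntegral_comp_preimage
      measurableSet_Ioi measurable_lineDensity]
    have : Neg.neg ⁻¹' Set.Ioi (1 : ℝ) = Set.Iio (-1) := by ext t; simp [lt_neg]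
    rw [this]
    simp [lineDensity]
  have hIcc : ∫⁻ t in Set.Icc (-1 : ℝ) 1, lineDensity t = 2 := by
    rw [setLIntegral_congr_fun measurableSet_Icc (g := fun _ => 1)]
    · simp
      norm_num
    · intro t ht
      have : ‖t‖ ≤ 1 := abs_le.2 ht
      simp only [lineDensity, max_eq_left (pow_le_one₀ (norm_nonneg t) this), inv_one,
        ENNReal.ofReal_one]
  have hc : (Set.Icc (-1 : ℝ) 1)ᶜ = Set.Iio (-1) ∪ Set.Ioi 1 := by
    ext t
    simp only [Set.mem_compl_iff, Set.mem_Icc, not_and_or, not_le, Set.mem_union, Set.mem_Iio,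
      Set.mem_Ioi]
  rw [← lintegral_add_compl _ (measurableSet_Icc (a := (-1 : ℝ)) (b := 1)), hc,
    lintegral_union measurableSet_Ioi, hIcc, hIio, hIoi]
  · norm_num
  · rw [Set.disjoint_left]
    intro t h1 h2
    simp only [Set.mem_Iio, Set.mem_Ioi] at h1 h2
    linarith

/-! ### $p$-adic volumes and the volume of the integral points -/

section Padic

variable (p : ℕ) [hp : Fact p.Prime]

instance : (padicHaar p).IsAddHaarMeasure := by unfold padicHaar; infer_instance

theorem padicHaar_closedBall_one : padicHaar p (Metric.closedBall 0 1) = 1 :=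
  Measure.addHaarMeasure_self

variable {p} in
-- Multiplication by $p^{k+1}$ carries $t$ into $\mathbb Z_p$, where $n$ is the representative in
-- $\{0,\dots,p-1\}$ of its residue class modulo $p$.
theorem existsUnique_norm_sub_le {k : ℤ} {t : ℚ_[p]} (ht : ‖t‖ ≤ (p : ℝ) ^ (k + 1)) :
    ∃! n : ℕ, n < p ∧ ‖t - n * (p : ℚ_[p]) ^ (-(k + 1))‖ ≤ (p : ℝ) ^ k := by
  have hp0 : (0 : ℝ) < p := by exact_mod_cast hp.out.pos
  have hpq : (p : ℚ_[p]) ≠ 0 := by exact_mod_cast hp.out.ne_zero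
  have hs : ‖t * (p : ℚ_[p]) ^ (k + 1)‖ ≤ 1 := by
    rw [norm_mul, Padic.norm_p_zpow]
    calc _ ≤ (p : ℝ) ^ (k + 1) * (p : ℝ) ^ (-(k + 1)) := by gcongr
      _ = 1 := by rw [← zpow_add₀ hp0.ne']; simp
  obtain ⟨s, hs⟩ : ∃ s : ℤ_[p], (s : ℚ_[p]) = t * (p : ℚ_[p]) ^ (k + 1) := ⟨⟨_, hs⟩, rfl⟩
  have key : ∀ n : ℕ, s - n ∈ IsLocalRing.maximalIdeal ℤ_[p] ↔
      ‖t - n * (p : ℚ_[p]) ^ (-(k + 1))‖ ≤ (p : ℝ) ^ k := by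
    intro n
    have e : t - n * (p : ℚ_[p]) ^ (-(k + 1)) =
        (t * (p : ℚ_[p]) ^ (k + 1) - n) * (p : ℚ_[p]) ^ (-(k + 1)) := by
      rw [sub_mul, mul_assoc, ← zpow_add₀ hpq]; simp
    rw [IsLocalRing.mem_maximalIdeal, PadicInt.mem_nonunits, Padic.norm_le_pow_iff_norm_lt_pow_add_one,
      e, norm_mul, Padic.norm_p_zpow, neg_neg, mul_lt_iff_lt_one_left (zpow_pos hp0 _),
      PadicInt.norm_def, PadicInt.coe_sub, PadicInt.coe_natCast, hs]
  simp only [← key]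
  exact PadicInt.existsUnique_mem_range _

/-- The larger ball is the disjoint union of $p$ translates of the smaller one. -/
theorem padicHaar_closedBall_zpow_add_one (k : ℤ) :
    padicHaar p (Metric.closedBall 0 ((p : ℝ) ^ (k + 1))) =
      p * padicHaar p (Metric.closedBall 0 ((p : ℝ) ^ k)) := by
  have hp1 : (1 : ℝ) ≤ p := by exact_mod_cast hp.out.one_le
  have hU : Metric.closedBall (0 : ℚ_[p]) ((p : ℝ) ^ (k + 1)) = ⋃ n ∈ Finset.range p,
      (fun t => t + -((n : ℚ_[p]) * (p : ℚ_[p]) ^ (-(k + 1)))) ⁻¹'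
        Metric.closedBall 0 ((p : ℝ) ^ k) := by
    ext t
    simp only [mem_closedBall_zero_iff, Set.mem_iUnion, Finset.mem_range, Set.mem_preimage,
      ← sub_eq_add_neg, exists_prop]
    constructor
    · exact fun h => (existsUnique_norm_sub_le h).exists
    · rintro ⟨n, -, h⟩
      have h1 : ‖(n : ℚ_[p]) * (p : ℚ_[p]) ^ (-(k + 1))‖ ≤ (p : ℝ) ^ (k + 1) := by
        rw [norm_mul, Padic.norm_p_zpow, neg_neg]
        exact mul_le_of_le_one_left (by positivity) (IsUltrametricDist.norm_natCast_le_one _ n)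
      have h2 : (p : ℝ) ^ k ≤ (p : ℝ) ^ (k + 1) := zpow_le_zpow_right₀ hp1 (by omega)
      rw [← sub_add_cancel t ((n : ℚ_[p]) * (p : ℚ_[p]) ^ (-(k + 1)))]
      exact (Padic.nonarchimedean _ _).trans (max_le (h.trans h2) h1)
  rw [hU, measure_biUnion_finset]
  · simp only [measure_preimage_add_right, Finset.sum_const, Finset.card_range, nsmul_eq_mul]
  · intro m hm n hn hmn
    refine Set.disjoint_left.2 fun t h1 h2 => hmn ?_
    have ht : ‖t‖ ≤ (p : ℝ) ^ (k + 1) := by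
      rw [← mem_closedBall_zero_iff, hU]
      exact Set.mem_biUnion hm h1
    simp only [Set.mem_preimage, mem_closedBall_zero_iff, ← sub_eq_add_neg] at h1 h2
    exact (existsUnique_norm_sub_le ht).unique ⟨Finset.mem_range.1 hm, h1⟩
      ⟨Finset.mem_range.1 hn, h2⟩
  · exact fun n _ => (measurable_add_const _) Metric.isClosed_closedBall.measurableSet

theorem padicHaar_closedBall_zpow (k : ℤ) :
    padicHaar p (Metric.closedBall 0 ((p : ℝ) ^ k)) = ENNReal.ofReal ((p : ℝ) ^ k) := by
  have hp0 : (0 : ℝ) < p := by exact_mod_cast hp.out.pos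
  have hpe : (p : ℝ≥0∞) = ENNReal.ofReal p := by simp
  induction k with
  | zero => simpa using padicHaar_closedBall_one p
  | succ k ih =>
    rw [padicHaar_closedBall_zpow_add_one, ih, hpe, ← ENNReal.ofReal_mul hp0.le,
      zpow_add_one₀ hp0.ne', mul_comm]
  | pred k ih =>
    have h := padicHaar_closedBall_zpow_add_one p (-(k : ℤ) - 1)
    rw [sub_add_cancel, ih] at h
    have hp0' : (p : ℝ≥0∞) ≠ 0 := by exact_mod_cast hp.out.ne_zero
    rw [← ENNReal.mul_right_inj hp0' (ENNReal.natCast_ne_top p), ← h, hpe,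
      ← ENNReal.ofReal_mul hp0.le, zpow_sub_one₀ hp0.ne']
    congr 1
    field_simp

theorem padicHaar_sphere_zpow (k : ℤ) :
    padicHaar p {t | ‖t‖ = (p : ℝ) ^ k} =
      ENNReal.ofReal ((p : ℝ) ^ k * (1 - (p : ℝ)⁻¹)) := by
  have hp0 : (0 : ℝ) < p := by exact_mod_cast hp.out.pos
  have hp1 : (1 : ℝ) ≤ p := by exact_mod_cast hp.out.one_le
  -- Norms of nonzero elements are powers of $p$, so the next smaller ball has radius $p^{k-1}$.
  have : {t : ℚ_[p] | ‖t‖ = (p : ℝ) ^ k} =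
      Metric.closedBall 0 ((p : ℝ) ^ k) \ Metric.closedBall 0 ((p : ℝ) ^ (k - 1)) := by
    ext t
    rw [Set.mem_sdiff, mem_closedBall_zero_iff, mem_closedBall_zero_iff,
      Padic.norm_le_pow_iff_norm_lt_pow_add_one t (k - 1), sub_add_cancel, not_lt, Set.mem_ofPred_eq]
    exact le_antisymm_iff
  rw [this, measure_sdiff (Metric.closedBall_subset_closedBall
    (zpow_le_zpow_right₀ hp1 (by omega))) Metric.isClosed_closedBall.nullMeasurableSet,
    padicHaar_closedBall_zpow, padicHaar_closedBall_zpow, ← ENNReal.ofReal_sub _ (by positivity),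
    zpow_sub_one₀ hp0.ne', mul_sub, mul_one]
  · rw [padicHaar_closedBall_zpow]
    exact ENNReal.ofReal_ne_top

/-- The function `|t|⁻²` on the complement of `ℤ_p`. -/
noncomputable def tailDensity (t : ℚ_[p]) : ℝ≥0∞ := if 1 < ‖t‖ then ENNReal.ofReal (‖t‖ ^ 2)⁻¹ else 0

theorem measurable_tailDensity : Measurable (tailDensity p) :=
  Measurable.ite (measurableSet_lt measurable_const measurable_norm) (by fun_prop) measurable_const

/-- The sphere of radius $p^{n+1}$ contributes $p^{n+1}(1-p^{-1})\cdot p^{-2(n+1)}$, a geometric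
series in $n\ge0$ with sum $p^{-1}$. -/
theorem lintegral_tailDensity :
    ∫⁻ t, tailDensity p t ∂padicHaar p = ENNReal.ofReal (p : ℝ)⁻¹ := by
  have hp0 : (0 : ℝ) < p := by exact_mod_cast hp.out.pos
  have hp1 : (1 : ℝ) < p := by exact_mod_cast hp.out.one_lt
  have hi1 : (p : ℝ)⁻¹ < 1 := inv_lt_one_of_one_lt₀ hp1
  have e : ∀ t, tailDensity p t = ∑' n : ℕ, Set.indicator {t : ℚ_[p] | ‖t‖ = (p : ℝ) ^ (n + 1 : ℤ)}
      (fun _ => ENNReal.ofReal (((p : ℝ) ^ (n + 1 : ℤ)) ^ 2)⁻¹) t := by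
    intro t
    rw [tailDensity]
    split_ifs with h
    · have ht : t ≠ 0 := by rintro rfl; simp at h; linarith
      obtain ⟨n, hn⟩ : ∃ n : ℕ, ‖t‖ = (p : ℝ) ^ (n + 1 : ℤ) := by
        have h2 := Padic.norm_eq_zpow_neg_valuation ht
        rw [h2] at h
        have h3 : 0 < -t.valuation := (one_lt_zpow_iff_right₀ hp1).1 h
        obtain ⟨n, hn⟩ := Int.eq_ofNat_of_zero_le (Int.le_sub_one_of_lt h3)
        exact ⟨n, by rw [h2]; congr 1; omega⟩
      rw [tsum_eq_single n]
      · rw [Set.indicator_of_mem (by exact hn), hn]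
      · intro m hm
        refine Set.indicator_of_notMem (fun hm' => hm ?_) _
        have := zpow_right_injective₀ hp0 hp1.ne' ((show ‖t‖ = _ from hm').symm.trans hn)
        omega
    · symm
      refine ENNReal.tsum_eq_zero.2 fun n => Set.indicator_of_notMem (fun hn => h ?_) _
      rw [show ‖t‖ = _ from hn]
      exact one_lt_zpow₀ hp1 (by omega)
  have hm : ∀ n : ℕ, MeasurableSet {t : ℚ_[p] | ‖t‖ = (p : ℝ) ^ (n + 1 : ℤ)} := fun n =>
    measurableSet_eq_fun measurable_norm measurable_const
  simp_rw [e]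
  rw [lintegral_tsum fun n => (measurable_const.indicator (hm n)).aemeasurable]
  have e2 : ∀ n : ℕ, ∫⁻ t, Set.indicator {t : ℚ_[p] | ‖t‖ = (p : ℝ) ^ (n + 1 : ℤ)}
      (fun _ => ENNReal.ofReal (((p : ℝ) ^ (n + 1 : ℤ)) ^ 2)⁻¹) t ∂padicHaar p =
      ENNReal.ofReal ((1 - (p : ℝ)⁻¹) * (p : ℝ)⁻¹ * ((p : ℝ)⁻¹) ^ n) := by
    intro n
    rw [lintegral_indicator_const (hm n), padicHaar_sphere_zpow,
      ← ENNReal.ofReal_mul (by positivity)]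
    congr 1
    rw [zpow_add_one₀ hp0.ne', zpow_natCast, inv_pow]
    field_simp
  simp_rw [e2]
  rw [← ENNReal.ofReal_tsum_of_nonneg, tsum_mul_left, tsum_geometric_of_lt_one (by positivity) hi1]
  · have : 1 - (p : ℝ)⁻¹ ≠ 0 := (sub_pos.2 hi1).ne'
    congr 1
    rw [mul_right_comm, mul_inv_cancel₀ this, one_mul]
  · intro n
    have := sub_pos.2 hi1
    positivity
  · exact (summable_geometric_of_lt_one (by positivity) hi1).mul_left _

/-- The indicator function of `ℤ_p`. -/
noncomputable def integerIndicator : ℚ_[p] → ℝ≥0∞ := Set.indicator {t | ‖t‖ ≤ 1} 1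

/-- The indicator function of `ℤ_pˣ`. -/
noncomputable def unitIndicator : ℚ_[p] → ℝ≥0∞ := Set.indicator {t | ‖t‖ = 1} 1

theorem measurable_integerIndicator : Measurable (integerIndicator p) :=
  measurable_one.indicator (measurableSet_le measurable_norm measurable_const)

theorem measurable_unitIndicator : Measurable (unitIndicator p) :=
  measurable_one.indicator (measurableSet_eq_fun measurable_norm measurable_const)

theorem lintegral_integerIndicator : ∫⁻ t, integerIndicator p t ∂padicHaar p = 1 := by
  rw [integerIndicator, lintegral_indicator_one (measurableSet_le measurable_norm measurable_const),
    ← padicHaar_closedBall_one p]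
  congr 1
  ext
  simp

theorem lintegral_unitIndicator :
    ∫⁻ t, unitIndicator p t ∂padicHaar p = ENNReal.ofReal (1 - (p : ℝ)⁻¹) := by
  rw [unitIndicator,
    lintegral_indicator_one (measurableSet_eq_fun measurable_norm measurable_const)]
  simpa using padicHaar_sphere_zpow p 0

theorem lineDensity_padic (t : ℚ_[p]) : lineDensity t = integerIndicator p t + tailDensity p t := by
  simp only [lineDensity, integerIndicator, tailDensity, Set.indicator_apply, Set.mem_ofPred_eq]
  rcases le_or_gt ‖t‖ 1 with h | h
  · simp only [h, h.not_gt, max_eq_left (pow_le_one₀ (norm_nonneg t) h), if_true, if_false, inv_one,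
      ENNReal.ofReal_one, Pi.one_apply, add_zero]
  · simp only [h, h.not_ge, max_eq_right (one_le_pow₀ h.le), if_true, if_false, zero_add]

theorem lintegral_lineDensity_padic :
    ∫⁻ t : ℚ_[p], lineDensity t ∂padicHaar p = ENNReal.ofReal (1 + (p : ℝ)⁻¹) := by
  simp_rw [lineDensity_padic]
  rw [lintegral_add_left (measurable_integerIndicator p), lintegral_integerIndicator,
    lintegral_tailDensity, ENNReal.ofReal_add zero_le_one (by positivity), ENNReal.ofReal_one]

/-- On the first chart, the density of `τ_U` on `𝔘(ℤ_p)` is a sum of two products. -/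
theorem indicator_integralPoints_density (u : Fin 3 → ℚ_[p]) :
    Set.indicator (param 0 ⁻¹' integralPoints p)
      (fun u => (ENNReal.ofReal (formNorm 0 u))⁻¹) u =
    (∏ j, (![unitIndicator p, lineDensity, lineDensity] : Fin 3 → ℚ_[p] → ℝ≥0∞) j (u j)) +
    ∏ j, (![tailDensity p, integerIndicator p, integerIndicator p] :
      Fin 3 → ℚ_[p] → ℝ≥0∞) j (u j) := by
  classical
  have h0 : ∀ t : ℚ_[p], 0 < max 1 (‖t‖ ^ 2) := fun t => lt_of_lt_of_le one_pos (le_max_left _ _)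
  simp only [Set.indicator_apply, Set.mem_preimage, param_zero_mem_integralPoints_iff, formNorm_zero,
    Fin.prod_univ_three, Matrix.cons_val, unitIndicator, integerIndicator, tailDensity,
    Set.mem_ofPred_eq, Pi.one_apply]
  by_cases h1 : ‖u 0‖ = 1
  · have : max (max 1 (‖u 1‖ ^ 2) * max 1 (‖u 2‖ ^ 2)) 1 =
        max 1 (‖u 1‖ ^ 2) * max 1 (‖u 2‖ ^ 2) :=
      max_eq_left (one_le_mul_of_one_le_of_one_le (le_max_left _ _) (le_max_left _ _))
    simp only [h1, this, lineDensity, true_or, if_true, lt_irrefl, if_false, zero_mul, add_zero,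
      one_mul, one_pow, max_self, div_one,
      ← ENNReal.ofReal_mul (inv_nonneg.2 (h0 (u 1)).le), ← mul_inv,
      ENNReal.ofReal_inv_of_pos (mul_pos (h0 (u 1)) (h0 (u 2)))]
  · by_cases h2 : 1 < ‖u 0‖
    · by_cases hb : ‖u 1‖ ≤ 1
      · by_cases hc : ‖u 2‖ ≤ 1
        · have hpos : 0 < ‖u 0‖ := one_pos.trans h2
          have e1 : max 1 (‖u 1‖ ^ 2) = 1 := max_eq_left (pow_le_one₀ (norm_nonneg _) hb)
          have e2 : max 1 (‖u 2‖ ^ 2) = 1 := max_eq_left (pow_le_one₀ (norm_nonneg _) hc)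
          have e3 : max 1 (‖u 0‖ ^ 2) = ‖u 0‖ ^ 2 := max_eq_right (one_le_pow₀ h2.le)
          -- For $|a|>1$ and integral $b,c$ the section $a^2$ dominates, and the factor $|a|$ of
          -- $1_D$ cancels $\max(1,|a|)$.
          have e4 : ‖u 0‖ * (‖u 0‖ ^ 2 / ‖u 0‖) = ‖u 0‖ ^ 2 := by field_simp
          simp only [h1, h2, hb, hc, e1, e2, e3, max_eq_right h2.le, e4, mul_one, if_true, if_false,
            and_self, or_true, zero_mul, zero_add, ENNReal.ofReal_inv_of_pos (pow_pos hpos 2)]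
        · simp [h1, hc]
      · simp [h1, hb]
    · simp [h1, h2]

theorem tamagawaU_integralPoints : tamagawaU (padicHaar p) (integralPoints p) =
    ENNReal.ofReal (1 + 2 / (p : ℝ) - 1 / (p : ℝ) ^ 2 - 1 / (p : ℝ) ^ 3) := by
  have hp0 : (0 : ℝ) < p := by exact_mod_cast hp.out.pos
  have hi1 : (p : ℝ)⁻¹ ≤ 1 := inv_le_one_of_one_le₀ (by exact_mod_cast hp.out.one_le)
  have hi0 : 0 ≤ 1 - (p : ℝ)⁻¹ := sub_nonneg.2 hi1
  have hmeas : Measurable (param 0 : (Fin 3 → ℚ_[p]) → X ℚ_[p]) := (continuous_param 0).measurable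
  have hS : MeasurableSet (integralPoints p) := isOpen_integralPoints.measurableSet
  have hF : ∀ j, Measurable
      ((![unitIndicator p, lineDensity, lineDensity] : Fin 3 → ℚ_[p] → ℝ≥0∞) j) := by
    intro j
    fin_cases j
    exacts [measurable_unitIndicator p, measurable_lineDensity, measurable_lineDensity]
  have hG : ∀ j, Measurable ((![tailDensity p, integerIndicator p, integerIndicator p] :
      Fin 3 → ℚ_[p] → ℝ≥0∞) j) := by
    intro j
    fin_cases j
    exacts [measurable_tailDensity p, measurable_integerIndicator p, measurable_integerIndicator p]
  -- The integral points lie in $U$ by definition, so restricting to $U$ changes nothing.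
  rw [tamagawaU, Measure.restrict_eq_self (s := integralPoints p) _ Set.inter_subset_left, logTamagawaMeasure_eq_map,
    Measure.map_apply hmeas hS, withDensity_apply _ (hmeas hS), ← lintegral_indicator (hmeas hS)]
  simp_rw [indicator_integralPoints_density]
  have hF' : Measurable fun u : Fin 3 → ℚ_[p] => ∏ j,
      (![unitIndicator p, lineDensity, lineDensity] : Fin 3 → ℚ_[p] → ℝ≥0∞) j (u j) :=
    Finset.measurable_prod _ fun j _ => (hF j).comp (measurable_pi_apply j)
  rw [lintegral_add_left hF', lintegral_fin_prod_eq_prod _ _ hF,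
    lintegral_fin_prod_eq_prod _ _ hG]
  simp only [Fin.prod_univ_three, Matrix.cons_val, lintegral_unitIndicator,
    lintegral_lineDensity_padic, lintegral_tailDensity, lintegral_integerIndicator, mul_one]
  rw [← ENNReal.ofReal_mul hi0, ← ENNReal.ofReal_mul (by positivity),
    ← ENNReal.ofReal_add (by positivity) (by positivity)]
  congr 1
  field_simp
  ring

end Padic

end ToricThreefold

theorem lemma3p9 :
    ToricThreefold.tamagawaM (MeasureTheory.volume : MeasureTheory.Measure ℝ)
        (ToricThreefold.M ℝ) = 16 ∧
      ToricThreefold.residueMeasureM (ToricThreefold.M ℝ) = 32 ∧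
      ∀ (p : ℕ) [Fact p.Prime],
        ToricThreefold.tamagawaU (ToricThreefold.padicHaar p) (ToricThreefold.integralPoints p) =
          ENNReal.ofReal (1 + 2 / (p : ℝ) - 1 / (p : ℝ) ^ 2 - 1 / (p : ℝ) ^ 3) := by
  have h : ToricThreefold.tamagawaM (volume : Measure ℝ) (ToricThreefold.M ℝ) = 16 := by
    rw [ToricThreefold.tamagawaM_M, ToricThreefold.lintegral_lineDensity_real]
    norm_num
  refine ⟨h, ?_, fun p _ => ToricThreefold.tamagawaU_integralPoints p⟩
  rw [ToricThreefold.residueMeasureM, Measure.smul_apply, h, Real.volume_closedBall]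
  norm_num
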